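/- Let $\mathbb{T}^2=(\mathbb{R}/\mathbb{Z})^2$, $T>0$ and $1\le p<\infty$; write $L^2_x=L^2(\mathbb{T}^2;\mathbb{R}^2)$. A sequence $\{u_k\}_{k\in\mathbb{N}}$ that is uniformly bounded in $L^\infty(0,T;L^2_x)$ is called an approximate solution sequence for the incompressible Euler equations if 1. $\{u_k\}$ is uniformly bounded in $\mathrm{Lip}([0,T);H^{-L}(\mathbb{T}^2;\mathbb{R}^2))$ for some $L>1$ (each $u_k$ being identified with its continuous representative $[0,T)\to H^{-L}$, which takes values in $L^2_x$); 2. for every $\Phi\in C_c^\infty([0,T)\times\mathbb{T}^2;\mathbb{R}^2)$ with $\operatorname{div}\Phi=0$, $$\lim_{k\to\infty}\left[\int_0^T\!\int_{\mathbb{T}^2}\Big(\Phi_t\cdot u_k+\nabla\Phi:(u_k\otimes u_k)\Big)\,dx\,dt+\int_{\mathbb{T}^2}\Phi(x,0)\cdot u_k(x,0)\,dx\right]=0;$$ 3. $\operatorname{div}u_k=0$ in the sense of distributions on $[0,T]\times\mathbb{T}^2$, for every $k$. For $u\in L^2_x$, and for $u\in L^2(0,T;L^2_x)$ respectively, and $r>0$,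 define the structure functions $$S_2(u;r)=\left(\int_{\mathbb{T}^2}\frac{1}{|B_r(0)|}\int_{B_r(0)}|u(x+h)-u(x)|^2\,dh\,dx\right)^{1/2},\qquad S_2^T(u;r)=\left(\int_0^T S_2(u(t);r)^2\,dt\right)^{1/2},$$ where $B_r(0)\subset\mathbb{R}^2$ is the Euclidean ball. **Proposition.** Let $\{u_k\}_{k\in\mathbb{N}}$ be an approximate solution sequence for the incompressible Euler equations. Then $\{u_k\}$ is relatively compact in the norm topology of $L^p(0,T;L^2_x)$ if and only if there is a function $\phi:[0,\infty)\to[0,\infty)$ with $\phi(r)\to0$ as $r\to0$ such that $$S_2^T(u_k;r)\le\phi(r)\qquad\text{for all } r>0 \text{ and all } k\in\mathbb{N}.$$ -/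

import Mathlib

open MeasureTheory Set Filter Topology
open scoped ENNReal ContDiff

noncomputable section

namespace EulerCompactness

/-- The plane `ℝ²` with its Euclidean norm. -/
abbrev Plane : Type := EuclideanSpace ℝ (Fin 2)

/-- The two-dimensional torus `𝕋² = (ℝ/ℤ)²`. -/
abbrev Torus : Type := UnitAddTorus (Fin 2)

/-- The normalized Haar measure of `𝕋²`, i.e. Lebesgue measure of `[0,1)²`. -/
abbrev torusMeasure : Measure Torus := Measure.pi fun _ => AddCircle.haarAddCircle

/-- The covering map `ℝ² → 𝕋²`. -/
def proj (h : Plane) : Torus := fun i => ((h i : ℝ) : UnitAddCircle)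

/-- `L²_x = L²(𝕋²; ℝ²)`. -/
abbrev L2x : Type := Lp Plane 2 torusMeasure

/-- Lebesgue measure on the time interval `(0,T)`. -/
abbrev timeMeasure (T : ℝ) : Measure ℝ := volume.restrict (Ioo 0 T)

/-- The norm of `H^{-L}(𝕋²; ℝ²)` on vector fields `v ∈ L²(𝕋²; ℝ²) ⊆ H^{-L}(𝕋²; ℝ²)`,
`‖v‖² = ∑_{n ∈ ℤ²} (1 + |n|²)^{-L} |v̂(n)|²`. For `L > 0` the series converges by Parseval. -/
def negSobolevNorm (L : ℝ) (v : L2x) : ℝ :=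
  Real.sqrt (∑' n : Fin 2 → ℤ, (1 + ∑ i, (n i : ℝ) ^ 2) ^ (-L) *
    ∑ j : Fin 2, ‖UnitAddTorus.mFourierCoeff (fun x : Torus => ((v x j : ℝ) : ℂ)) n‖ ^ 2)

/-- A map on `ℝ × 𝕋²` is smooth if its lift to `ℝ × ℝ²` is. Every map that is smooth on
`[0,T) × 𝕋²` up to `t = 0`, with compact support there, is the restriction of one of these. -/
def SmoothField {E : Type*} [NormedAddCommGroup E] [NormedSpace ℝ E]
    (Φ : ℝ → Torus → E) : Prop :=
  ContDiff ℝ ∞ fun z : ℝ × Plane => Φ z.1 (proj z.2)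

/-- The spatial derivative `v ↦ (v · ∇) f (x)` of a map `f` on the torus at the point `x`. -/
def spaceDeriv {E : Type*} [NormedAddCommGroup E] [NormedSpace ℝ E]
    (f : Torus → E) (x : Torus) : Plane →L[ℝ] E :=
  fderiv ℝ (fun h : Plane => f (x + proj h)) 0

/-- The divergence `∑ᵢ ∂ᵢ fᵢ (x)` of a vector field on the torus. -/
def divergence (f : Torus → Plane) (x : Torus) : ℝ :=
  ∑ i, spaceDeriv f x (EuclideanSpace.single i 1) i

/-- Divergence-free test vector fields `Φ ∈ C_c^∞([0,T) × 𝕋²; ℝ²)`. -/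
structure IsTestField (T : ℝ) (Φ : ℝ → Torus → Plane) : Prop where
  smooth : SmoothField Φ
  support : ∃ τ < T, ∀ t, τ < t → ∀ x, Φ t x = 0
  div_free : ∀ t ∈ Ico 0 T, ∀ x, divergence (Φ t) x = 0

/-- The left-hand side of the weak form of the Euler equations,
`∫₀ᵀ ∫ Φ_t · u + ∇Φ : (u ⊗ u) dx dt + ∫ Φ(x,0) · u(x,0) dx`; here
`∇Φ : (u ⊗ u) = ∑ᵢⱼ ∂ⱼΦᵢ uᵢ uⱼ = ((u · ∇) Φ) · u`. -/
def eulerResidual (T : ℝ) (Φ : ℝ → Torus → Plane) (u : ℝ → L2x) : ℝ :=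
  (∫ t in Ioo 0 T, ∫ x, (inner ℝ (deriv (fun s => Φ s x) t) (u t x)
      + inner ℝ (spaceDeriv (Φ t) x (u t x)) (u t x)) ∂torusMeasure)
    + ∫ x, inner ℝ (Φ 0 x) (u 0 x) ∂torusMeasure

/-- `div u = 0` in the sense of distributions on `[0,T] × 𝕋²`. -/
def WeaklyDivFree (T : ℝ) (u : ℝ → L2x) : Prop :=
  ∀ ψ : ℝ → Torus → ℝ, SmoothField ψ →
    ∫ t in Ioo 0 T, ∫ x, spaceDeriv (ψ t) x (u t x) ∂torusMeasure = 0

/-- Approximate solution sequences for the incompressible Euler equations on `[0,T] × 𝕋²`.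
The element `u_k` of `L^∞(0,T;L²) ∩ Lip([0,T);H^{-L})` is given by its continuous representative
`[0,T) → H^{-L}`. By weak compactness of balls of `L²`, that representative takes its values in
`L²` at every time in `[0,T)`, including `t = 0`. Values at times outside `[0,T)` play no role. -/
structure IsApproximateSolutionSequence (T : ℝ) (u : ℕ → ℝ → L2x) : Prop where
  aestronglyMeasurable : ∀ k, AEStronglyMeasurable (u k) (timeMeasure T)
  bounded : ∃ M : ℝ, ∀ k, ∀ᵐ t ∂timeMeasure T, ‖u k t‖ ≤ M
  lipschitz : ∃ L : ℝ, 1 < L ∧ ∃ C : ℝ, ∀ k,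
    (∀ t ∈ Ico 0 T, negSobolevNorm L (u k t) ≤ C) ∧
    ∀ s ∈ Ico 0 T, ∀ t ∈ Ico 0 T, negSobolevNorm L (u k t - u k s) ≤ C * |t - s|
  consistent : ∀ Φ, IsTestField T Φ →
    Tendsto (fun k => eulerResidual T Φ (u k)) atTop (𝓝 0)
  div_free : ∀ k, WeaklyDivFree T (u k)

/-- The members of an approximate solution sequence belong to `L^p(0,T;L²_x)` for every `p`. -/
theorem IsApproximateSolutionSequence.memLp {T : ℝ} {u : ℕ → ℝ → L2x}
    (hu : IsApproximateSolutionSequence T u) (p : ℝ≥0∞) (k : ℕ) :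
    MemLp (u k) p (timeMeasure T) := by
  obtain ⟨M, hM⟩ := hu.bounded
  exact MemLp.of_bound (hu.aestronglyMeasurable k) M (hM k)

/-- The structure function
`S₂(u;r) = (∫_{𝕋²} ⨍_{B_r(0)} |u(x+h) - u(x)|² dh dx)^{1/2}`. -/
def structureFunction (u : L2x) (r : ℝ) : ℝ :=
  Real.sqrt (∫ x, (⨍ h in Metric.ball (0 : Plane) r, ‖u (x + proj h) - u x‖ ^ 2) ∂torusMeasure)

/-- The time-integrated structure function `S₂ᵀ(u;r) = (∫₀ᵀ S₂(u(t);r)² dt)^{1/2}`. -/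
def timeStructureFunction (T : ℝ) (u : ℝ → L2x) (r : ℝ) : ℝ :=
  Real.sqrt (∫ t in Ioo 0 T, structureFunction (u t) r ^ 2)

/-- Moduli of continuity: maps `φ : [0,∞) → [0,∞)` with `φ(r) → 0` as `r → 0`. -/
structure IsModulusOfContinuity (φ : ℝ → ℝ) : Prop where
  nonneg : ∀ r, 0 ≤ r → 0 ≤ φ r
  tendsto_zero : Tendsto φ (𝓝[>] 0) (𝓝 0)

end EulerCompactness

end

open EulerCompactness

/-! The fields are uniformly bounded in `L²_x` on a finite time interval, so smallness in `L^p` in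
time and in `L²` in time are equivalent (`exists_pos_integral_rpow_le`), and everything reduces to
`∫₀ᵀ ‖u_k - u_l‖² dt`.

Compactness gives a modulus because a totally bounded family is approximated by finitely many of its
members, each with structure function tending to zero by strong continuity of translations
(`exists_modulusOfContinuity`).

For the converse, translation by `h` multiplies the mode `n` by `e^{2πi n·h}`, so `S₂(v;r)²` weights
the energy of that mode by `⨍_{B_r} |e^{2πi n·h} - 1|² dh`. By Riemann–Lebesgue the weight tends to
2 as `|n| → ∞`, hence is at least 1 off a finite set `F`, and `‖v‖² ≤ ∑_{n ∈ F} |v̂(n)|² + S₂(v;r)²`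
(`exists_finset_norm_sq_le`). For `v = u_k - u_l` the last term is uniformly small in time average
by the modulus, while the finitely many low modes converge along a subsequence by an Arzelà–Ascoli
argument based on the Lipschitz bound in `H^{-L}` (`exists_subseq_tendsto_modeEnergy`). -/

namespace EulerCompactness

/-! ### Translations on `L²(𝕋²; ℝ²)` -/

theorem continuous_proj : Continuous proj :=
  continuous_pi fun i => (AddCircle.continuous_mk' 1).comp (by fun_prop)

theorem measurePreserving_translate (h : Plane) :
    MeasurePreserving (fun x : Torus => x + proj h) torusMeasure torusMeasure :=
  measurePreserving_add_right torusMeasure (proj h)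

/-- Translation by `h`, as a linear isometry of `L²(𝕋²; ℝ²)`. -/
noncomputable def translate (h : Plane) : L2x →ₗᵢ[ℝ] L2x :=
  Lp.compMeasurePreservingₗᵢ ℝ _ (measurePreserving_translate h)

theorem coeFn_translate (h : Plane) (v : L2x) :
    translate h v =ᵐ[torusMeasure] fun x => v (x + proj h) :=
  Lp.coeFn_compMeasurePreserving v (measurePreserving_translate h)

theorem continuous_translate (v : L2x) : Continuous fun h => translate h v := by
  have hg : Continuous fun h : Plane =>
      (⟨fun x : Torus => x + proj h, by fun_prop⟩ : C(Torus, Torus)) := by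
    refine ContinuousMap.continuous_of_continuous_uncurry _ ?_
    have := continuous_proj
    simp only [Function.uncurry_def, ContinuousMap.coe_mk]
    fun_prop
  exact continuous_const.compMeasurePreservingLp (f := fun _ : Plane => v) hg
    measurePreserving_translate (by simp)

theorem translate_zero (v : L2x) : translate 0 v = v := by
  refine Lp.ext ?_
  filter_upwards [coeFn_translate 0 v] with x hx
  have : proj 0 = 0 := by ext i; simp [proj]
  rw [hx, this, add_zero]

theorem norm_sq_eq_integral (v : L2x) : ‖v‖ ^ 2 = ∫ x, ‖v x‖ ^ 2 ∂torusMeasure := by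
  rw [← real_inner_self_eq_norm_sq, L2.inner_def]
  simp

theorem integrable_norm_sq (v : L2x) : Integrable (fun x => ‖v x‖ ^ 2) torusMeasure :=
  (Lp.memLp v).integrable_norm_pow (by simp)

theorem norm_sq_translate_sub (h : Plane) (v : L2x) :
    ‖translate h v - v‖ ^ 2 = ∫ x, ‖v (x + proj h) - v x‖ ^ 2 ∂torusMeasure := by
  rw [norm_sq_eq_integral]
  refine integral_congr_ae ?_
  filter_upwards [Lp.coeFn_sub (translate h v) v, coeFn_translate h v] with x h1 h2
  rw [h1, Pi.sub_apply, h2]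

theorem norm_translate_sub_le (h : Plane) (v : L2x) : ‖translate h v - v‖ ≤ 2 * ‖v‖ := by
  have := norm_sub_le (translate h v) v
  rw [LinearIsometry.norm_map] at this
  linarith

/-! ### The structure function as a ball average of translation differences -/

/-- The uniform probability measure on the ball `B_r(0)`. -/
noncomputable abbrev ballMeasure (r : ℝ) : Measure Plane :=
  (volume.restrict (Metric.ball (0 : Plane) r) univ)⁻¹ •
    volume.restrict (Metric.ball (0 : Plane) r)

theorem isProbabilityMeasure_ballMeasure {r : ℝ} (hr : 0 < r) :
    IsProbabilityMeasure (ballMeasure r) := by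
  have : NeZero (volume.restrict (Metric.ball (0 : Plane) r)) :=
    ⟨by simpa [Measure.restrict_eq_zero] using (Metric.measure_ball_pos volume (0 : Plane) hr).ne'⟩
  have : IsFiniteMeasure (volume.restrict (Metric.ball (0 : Plane) r)) :=
    ⟨by rw [Measure.restrict_apply_univ]; exact measure_ball_lt_top⟩
  exact isProbabilityMeasureSMul

theorem ae_ballMeasure_mem (r : ℝ) : ∀ᵐ h ∂ballMeasure r, h ∈ Metric.ball (0 : Plane) r :=
  Measure.ae_smul_measure (ae_restrict_mem Metric.isOpen_ball.measurableSet) _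

/-- This is the Fubini hypothesis for `structureFunction_sq`. Translation invariance makes the inner
integral of `|v(x + h)|²` independent of `h`, hence integrable against a finite measure. -/
theorem integrable_translate_sub_prod (μ : Measure Plane) [IsFiniteMeasure μ] (v : L2x) :
    Integrable (fun z : Torus × Plane => ‖v (z.1 + proj z.2) - v z.1‖ ^ 2)
      (torusMeasure.prod μ) := by
  have hv : StronglyMeasurable v := Lp.stronglyMeasurable v
  have hm : StronglyMeasurable fun z : Torus × Plane => v (z.1 + proj z.2) :=
    hv.comp_measurable (by have := continuous_proj.measurable; fun_prop)
  have hm' : StronglyMeasurable fun z : Torus × Plane => v z.1 := hv.comp_measurable measurable_fst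
  have h1 : Integrable (fun z : Torus × Plane => ‖v z.1‖ ^ 2) (torusMeasure.prod μ) :=
    (integrable_norm_sq v).comp_fst μ
  have h2 : Integrable (fun z : Torus × Plane => ‖v (z.1 + proj z.2)‖ ^ 2)
      (torusMeasure.prod μ) := by
    refine (integrable_prod_iff' (hm.norm.pow 2).aestronglyMeasurable).2 ?_
    have hi (h : Plane) : Integrable (fun x => ‖v (x + proj h)‖ ^ 2) torusMeasure :=
      (measurePreserving_translate h).integrable_comp_of_integrable (integrable_norm_sq v)
    refine ⟨.of_forall hi, ?_⟩
    have (h : Plane) : ∫ x, ‖‖v (x + proj h)‖ ^ 2‖ ∂torusMeasure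
        = ∫ x, ‖‖v x‖ ^ 2‖ ∂torusMeasure :=
      integral_add_right_eq_self (μ := torusMeasure) (fun x => ‖‖v x‖ ^ 2‖) (proj h)
    exact (integrable_const _).congr (.of_forall fun h => (this h).symm)
  refine ((h1.const_mul 2).add (h2.const_mul 2)).mono' ((hm.sub hm').norm.pow 2).aestronglyMeasurable
    (.of_forall fun z => ?_)
  have h3 := norm_sub_le (v (z.1 + proj z.2)) (v z.1)
  have h4 := norm_nonneg (v (z.1 + proj z.2) - v z.1)
  simp only [norm_pow, norm_norm, Pi.add_apply]
  nlinarith [sq_nonneg (‖v (z.1 + proj z.2)‖ - ‖v z.1‖)]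

theorem structureFunction_sq {r : ℝ} (hr : 0 < r) (v : L2x) :
    structureFunction v r ^ 2 = ∫ h, ‖translate h v - v‖ ^ 2 ∂ballMeasure r := by
  have := isProbabilityMeasure_ballMeasure hr
  have h1 : ∫ x, (⨍ h in Metric.ball (0 : Plane) r, ‖v (x + proj h) - v x‖ ^ 2) ∂torusMeasure
      = ∫ h, ‖translate h v - v‖ ^ 2 ∂ballMeasure r := by
    simp_rw [norm_sq_translate_sub]
    exact integral_integral_swap (f := fun x h => ‖v (x + proj h) - v x‖ ^ 2)
      (integrable_translate_sub_prod (ballMeasure r) v)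
  rw [structureFunction, h1, Real.sq_sqrt (integral_nonneg fun h => by positivity)]

theorem continuous_norm_translate_sub (v : L2x) :
    Continuous fun h => ‖translate h v - v‖ ^ 2 :=
  ((continuous_translate v).sub continuous_const).norm.pow 2

theorem norm_sq_translate_sub_le (h : Plane) (v : L2x) :
    ‖translate h v - v‖ ^ 2 ≤ 4 * ‖v‖ ^ 2 := by
  nlinarith [norm_translate_sub_le h v, norm_nonneg (translate h v - v), norm_nonneg v]

theorem integrable_norm_translate_sub (μ : Measure Plane) [IsFiniteMeasure μ] (v : L2x) :
    Integrable (fun h => ‖translate h v - v‖ ^ 2) μ :=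
  .of_bound (continuous_norm_translate_sub v).aestronglyMeasurable (4 * ‖v‖ ^ 2)
    (.of_forall fun h => by simpa using norm_sq_translate_sub_le h v)

theorem structureFunction_sq_le {r : ℝ} (hr : 0 < r) (v : L2x) :
    structureFunction v r ^ 2 ≤ 4 * ‖v‖ ^ 2 := by
  have := isProbabilityMeasure_ballMeasure hr
  rw [structureFunction_sq hr]
  refine (integral_mono (integrable_norm_translate_sub _ v) (integrable_const _)
    fun h => norm_sq_translate_sub_le h v).trans ?_
  simp

theorem norm_add_sq_le_two_mul {E : Type*} [SeminormedAddCommGroup E] (a b : E) :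
    ‖a + b‖ ^ 2 ≤ 2 * ‖a‖ ^ 2 + 2 * ‖b‖ ^ 2 := by
  nlinarith [norm_add_le a b, norm_nonneg (a + b), sq_nonneg (‖a‖ - ‖b‖)]

theorem structureFunction_add_sq_le {r : ℝ} (hr : 0 < r) (v w : L2x) :
    structureFunction (v + w) r ^ 2
      ≤ 2 * structureFunction v r ^ 2 + 2 * structureFunction w r ^ 2 := by
  have := isProbabilityMeasure_ballMeasure hr
  simp only [structureFunction_sq hr]
  rw [← integral_const_mul, ← integral_const_mul, ← integral_add
    ((integrable_norm_translate_sub _ v).const_mul 2)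
    ((integrable_norm_translate_sub _ w).const_mul 2)]
  refine integral_mono (integrable_norm_translate_sub _ _)
    (((integrable_norm_translate_sub _ v).const_mul 2).add
    ((integrable_norm_translate_sub _ w).const_mul 2)) fun h => ?_
  have : translate h (v + w) - (v + w) = (translate h v - v) + (translate h w - w) := by
    rw [map_add]; abel
  simp only [this]
  exact norm_add_sq_le_two_mul _ _

theorem structureFunction_neg_sq {r : ℝ} (hr : 0 < r) (v : L2x) :
    structureFunction (-v) r ^ 2 = structureFunction v r ^ 2 := by
  simp only [structureFunction_sq hr]
  congr 1 with h
  rw [map_neg, ← neg_sub', norm_neg]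

theorem structureFunction_sub_sq_le {r : ℝ} (hr : 0 < r) (v w : L2x) :
    structureFunction (v - w) r ^ 2
      ≤ 2 * structureFunction v r ^ 2 + 2 * structureFunction w r ^ 2 := by
  rw [sub_eq_add_neg, ← structureFunction_neg_sq hr w]
  exact structureFunction_add_sq_le hr v (-w)

/-- Continuity on `L²` makes the structure function of a strongly measurable path measurable in
time. -/
theorem continuous_structureFunction_sq {r : ℝ} (hr : 0 < r) :
    Continuous fun v : L2x => structureFunction v r ^ 2 := by
  have := isProbabilityMeasure_ballMeasure hr
  simp only [structureFunction_sq hr]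
  refine continuous_iff_continuousAt.2 fun v => ?_
  refine continuousAt_of_dominated (bound := fun _ => 4 * (‖v‖ + 1) ^ 2)
    (.of_forall fun w => (continuous_norm_translate_sub w).aestronglyMeasurable) ?_
    (integrable_const _) (.of_forall fun h => ?_)
  · filter_upwards [Metric.ball_mem_nhds v one_pos] with w hw
    refine .of_forall fun h => ?_
    have h1 := norm_sq_translate_sub_le h w
    have h2 : ‖w‖ ≤ ‖v‖ + 1 := by
      have := norm_le_norm_add_norm_sub v w
      rw [mem_ball_iff_norm'] at hw
      linarith
    rw [norm_pow, norm_norm]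
    refine h1.trans ?_
    gcongr
  · have := (translate h).continuous
    fun_prop

theorem tendsto_structureFunction_sq (v : L2x) :
    Tendsto (fun r => structureFunction v r ^ 2) (𝓝[>] 0) (𝓝 0) := by
  rw [Metric.tendsto_nhds]
  intro ε hε
  have h0 : Tendsto (fun h => ‖translate h v - v‖ ^ 2) (𝓝 0) (𝓝 0) := by
    simpa [translate_zero] using (continuous_norm_translate_sub v).tendsto 0
  obtain ⟨δ, hδ, hb⟩ := Metric.eventually_nhds_iff_ball.1 (h0.eventually_lt_const (half_pos hε))
  filter_upwards [Ioo_mem_nhdsGT hδ] with r hr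
  have := isProbabilityMeasure_ballMeasure hr.1
  rw [Real.dist_eq, sub_zero, abs_of_nonneg (by positivity), structureFunction_sq hr.1]
  refine lt_of_le_of_lt ?_ (half_lt_self hε)
  refine (integral_mono_ae (integrable_norm_translate_sub _ v) (integrable_const (ε / 2)) ?_).trans
    (by simp)
  filter_upwards [ae_ballMeasure_mem r] with h hh
  exact (hb h (Metric.ball_subset_ball hr.2.le hh)).le

/-! ### Fourier coefficients, Parseval and the action of translations -/

/-- The `j`-th component of a planar vector, as a complex number. -/
noncomputable def complexCoord (j : Fin 2) : Plane →L[ℝ] ℂ :=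
  Complex.ofRealCLM ∘L EuclideanSpace.proj j

/-- The Fourier coefficients of the components of a vector field. -/
noncomputable def coef (v : L2x) (n : Fin 2 → ℤ) (j : Fin 2) : ℂ :=
  UnitAddTorus.mFourierCoeff (fun x : Torus => ((v x j : ℝ) : ℂ)) n

theorem coef_eq_integral (v : L2x) (n : Fin 2 → ℤ) (j : Fin 2) :
    coef v n j = ∫ x, UnitAddTorus.mFourier (-n) x * ((v x j : ℝ) : ℂ) ∂torusMeasure := rfl

theorem hasSum_norm_coef_sq (v : L2x) (j : Fin 2) :
    HasSum (fun n => ‖coef v n j‖ ^ 2) (∫ x, ‖v x j‖ ^ 2 ∂torusMeasure) := by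
  have h := UnitAddTorus.hasSum_sq_mFourierCoeff (d := Fin 2) ((complexCoord j).compLp v)
  have hc : ((complexCoord j).compLp v : Torus → ℂ) =ᵐ[torusMeasure] fun x => ((v x j : ℝ) : ℂ) :=
    (complexCoord j).coeFn_compLp v
  convert h using 1
  · ext n
    congr 2
    rw [coef_eq_integral]
    refine integral_congr_ae ?_
    filter_upwards [hc] with x hx
    rw [hx, smul_eq_mul]
  · refine integral_congr_ae ?_
    filter_upwards [hc] with x hx
    rw [hx, Complex.norm_real]

theorem integrable_coord (v : L2x) (j : Fin 2) :
    Integrable (fun x => ((v x j : ℝ) : ℂ)) torusMeasure :=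
  (complexCoord j).integrable_comp ((Lp.memLp v).integrable (by norm_num))

theorem integrable_mFourier_mul_coord (v : L2x) (n : Fin 2 → ℤ) (j : Fin 2) :
    Integrable (fun x => UnitAddTorus.mFourier n x * ((v x j : ℝ) : ℂ)) torusMeasure :=
  (integrable_coord v j).bdd_mul (c := 1) (UnitAddTorus.mFourier n).continuous.aestronglyMeasurable
    (.of_forall fun x => ((UnitAddTorus.mFourier n).norm_coe_le_norm x).trans
      UnitAddTorus.mFourier_norm.le)

theorem coef_sub (v w : L2x) (n : Fin 2 → ℤ) (j : Fin 2) :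
    coef (v - w) n j = coef v n j - coef w n j := by
  simp only [coef_eq_integral]
  rw [← integral_sub (integrable_mFourier_mul_coord v (-n) j)
    (integrable_mFourier_mul_coord w (-n) j)]
  refine integral_congr_ae ?_
  filter_upwards [Lp.coeFn_sub v w] with x hx
  rw [hx]
  simp [mul_sub]

theorem mFourier_apply_add (n : Fin 2 → ℤ) (x y : Torus) :
    UnitAddTorus.mFourier n (x + y) = UnitAddTorus.mFourier n x * UnitAddTorus.mFourier n y := by
  simp only [UnitAddTorus.mFourier, ContinuousMap.coe_mk, ← Finset.prod_mul_distrib, Pi.add_apply]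
  congr 1 with i
  simp [fourier_apply, smul_add, AddCircle.toCircle_add]

theorem mFourier_neg_mul_self (n : Fin 2 → ℤ) (x : Torus) :
    UnitAddTorus.mFourier (-n) x * UnitAddTorus.mFourier n x = 1 := by
  rw [← UnitAddTorus.mFourier_add, neg_add_cancel, UnitAddTorus.mFourier_zero]; rfl

theorem coef_translate (h : Plane) (v : L2x) (n : Fin 2 → ℤ) (j : Fin 2) :
    coef (translate h v) n j = UnitAddTorus.mFourier n (proj h) * coef v n j := by
  simp only [coef_eq_integral]
  rw [← integral_const_mul, ← integral_add_right_eq_self (μ := torusMeasure)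
    (fun x => UnitAddTorus.mFourier n (proj h) *
      (UnitAddTorus.mFourier (-n) x * ((v x j : ℝ) : ℂ))) (proj h)]
  refine integral_congr_ae ?_
  filter_upwards [coeFn_translate h v] with x hx
  rw [hx, mFourier_apply_add]
  -- After the change of variables `x ↦ x + h`, the claim is that the characters `e_{-n}(h)` and
  -- `e_n(h)` cancel.
  linear_combination (-UnitAddTorus.mFourier (-n) x * ((v (x + proj h) j : ℝ) : ℂ)) *
    mFourier_neg_mul_self n (proj h)

/-- The energy `∑ⱼ |v̂ⱼ(n)|²` of a vector field in the Fourier mode `n`. -/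
noncomputable def modeEnergy (v : L2x) (n : Fin 2 → ℤ) : ℝ := ∑ j, ‖coef v n j‖ ^ 2

theorem modeEnergy_nonneg (v : L2x) (n : Fin 2 → ℤ) : 0 ≤ modeEnergy v n := by
  unfold modeEnergy; positivity

/-- Parseval's identity. -/
theorem hasSum_modeEnergy (v : L2x) : HasSum (modeEnergy v) (‖v‖ ^ 2) := by
  have hi (j : Fin 2) : Integrable (fun x => ‖v x j‖ ^ 2) torusMeasure := by
    have : MemLp (fun x => v x j) 2 torusMeasure :=
      (EuclideanSpace.proj (𝕜 := ℝ) j).comp_memLp' (Lp.memLp v)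
    exact this.integrable_norm_pow (by simp)
  have : ‖v‖ ^ 2 = ∑ j, ∫ x, ‖v x j‖ ^ 2 ∂torusMeasure := by
    rw [norm_sq_eq_integral, ← integral_finsetSum _ fun j _ => hi j]
    simp only [EuclideanSpace.norm_sq_eq]
  rw [this]
  exact hasSum_sum fun j _ => hasSum_norm_coef_sq v j

theorem modeEnergy_translate_sub (h : Plane) (v : L2x) (n : Fin 2 → ℤ) :
    modeEnergy (translate h v - v) n
      = ‖UnitAddTorus.mFourier n (proj h) - 1‖ ^ 2 * modeEnergy v n := by
  simp only [modeEnergy, coef_sub, coef_translate, Finset.mul_sum, ← mul_pow, ← norm_mul]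
  congr! 3 with j
  ring_nf

/-! ### Riemann–Lebesgue and the control of high modes -/

theorem mFourier_proj (n : Fin 2 → ℤ) (h : Plane) :
    UnitAddTorus.mFourier n (proj h)
      = Real.fourierChar (inner ℝ h (WithLp.toLp 2 fun i => (n i : ℝ))) := by
  simp only [UnitAddTorus.mFourier, ContinuousMap.coe_mk, proj, fourier_coe_apply,
    Real.fourierChar_apply, PiLp.inner_apply, ← Complex.exp_sum]
  congr 1
  simp [Fin.sum_univ_two]
  ring

theorem tendsto_cofinite_cocompact_lattice :
    Tendsto (fun n : Fin 2 → ℤ => (WithLp.toLp 2 fun i => (n i : ℝ) : Plane)) cofinite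
      (cocompact Plane) := by
  have h1 : Tendsto (fun n : Fin 2 → ℤ => fun i => (n i : ℝ)) cofinite (cocompact (Fin 2 → ℝ)) := by
    rw [← Filter.coprodᵢ_cofinite, ← Filter.coprodᵢ_cocompact]
    exact Tendsto.pi_map_coprodᵢ fun _ => Int.tendsto_coe_cofinite
  exact (PiLp.homeomorph 2 fun _ : Fin 2 => ℝ).symm.isClosedEmbedding.tendsto_cocompact.comp h1

/-- Up to normalization this is the Fourier transform of the indicator of the ball at lattice
frequencies, which leave every compact set along `cofinite`. -/
theorem tendsto_integral_mFourier_proj (r : ℝ) :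
    Tendsto (fun n : Fin 2 → ℤ => ∫ h, UnitAddTorus.mFourier n (proj h) ∂ballMeasure r) cofinite
      (𝓝 0) := by
  have h1 := ((tendsto_integral_exp_inner_smul_cocompact (V := Plane)
    (indicator (Metric.ball (0 : Plane) r) fun _ => (1 : ℂ))).comp
      -- The Fourier transform carries the exponent `-⟨h, ξ⟩`, so it is evaluated at `ξ = -n`.
      ((Homeomorph.neg Plane).isClosedEmbedding.tendsto_cocompact.comp
        tendsto_cofinite_cocompact_lattice)).const_smul
          (volume.restrict (Metric.ball (0 : Plane) r) univ)⁻¹.toReal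
  rw [smul_zero] at h1
  refine h1.congr fun n => ?_
  rw [integral_smul_measure, ← integral_indicator Metric.isOpen_ball.measurableSet]
  simp only [Function.comp_apply]
  congr 2 with h
  by_cases hh : h ∈ Metric.ball (0 : Plane) r
  · have hs : (Homeomorph.neg Plane) (WithLp.toLp 2 fun i => (n i : ℝ))
        = -WithLp.toLp 2 fun i => (n i : ℝ) := rfl
    rw [indicator_of_mem hh, indicator_of_mem hh, mFourier_proj, hs, inner_neg_right, neg_neg,
      Circle.smul_def, smul_eq_mul, mul_one]
  · simp [hh]

theorem norm_mFourier_apply (n : Fin 2 → ℤ) (x : Torus) : ‖UnitAddTorus.mFourier n x‖ = 1 := by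
  simp only [UnitAddTorus.mFourier, fourier_apply, ContinuousMap.coe_mk, norm_prod,
    Circle.norm_coe, Finset.prod_const_one]

theorem norm_sub_one_sq_of_norm_eq_one {z : ℂ} (hz : ‖z‖ = 1) : ‖z - 1‖ ^ 2 = 2 - 2 * z.re := by
  have h : z.re * z.re + z.im * z.im = 1 := by
    rw [← Complex.normSq_apply, Complex.normSq_eq_norm_sq, hz, one_pow]
  rw [← Complex.normSq_eq_norm_sq, Complex.normSq_apply]
  simp only [Complex.sub_re, Complex.one_re, Complex.sub_im, Complex.one_im]
  linarith

/-- Since `|z - 1|² = 2 - 2 Re z` on the unit circle, the average is at least 1 once the mean of the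
character is below `1/2` in modulus. -/
theorem eventually_one_le_integral {r : ℝ} (hr : 0 < r) :
    ∀ᶠ n : Fin 2 → ℤ in cofinite,
      1 ≤ ∫ h, ‖UnitAddTorus.mFourier n (proj h) - 1‖ ^ 2 ∂ballMeasure r := by
  have := isProbabilityMeasure_ballMeasure hr
  filter_upwards [(tendsto_integral_mFourier_proj r).norm.eventually_lt_const
    (by simp : ‖(0 : ℂ)‖ < 1 / 2)] with n hn
  have hi : Integrable (fun h => UnitAddTorus.mFourier n (proj h)) (ballMeasure r) :=
    have := continuous_proj
    .of_bound (by fun_prop) 1 (.of_forall fun h => (norm_mFourier_apply n _).le)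
  simp only [norm_sub_one_sq_of_norm_eq_one (norm_mFourier_apply n _)]
  have hre : ∫ h, (UnitAddTorus.mFourier n (proj h)).re ∂ballMeasure r
      = (∫ h, UnitAddTorus.mFourier n (proj h) ∂ballMeasure r).re :=
    integral_re hi
  have hi' : Integrable (fun h => 2 * (UnitAddTorus.mFourier n (proj h)).re) (ballMeasure r) :=
    hi.re.const_mul 2
  rw [integral_sub (integrable_const _) hi', integral_const_mul, hre]
  have := (Complex.re_le_norm _).trans_lt hn
  simp only [integral_const, probReal_univ, one_smul]
  linarith

/-- The energy of a vector field is controlled by finitely many Fourier modes and by the structure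
function. -/
theorem exists_finset_norm_sq_le {r : ℝ} (hr : 0 < r) :
    ∃ F : Finset (Fin 2 → ℤ), ∀ v : L2x,
      ‖v‖ ^ 2 ≤ ∑ n ∈ F, modeEnergy v n + structureFunction v r ^ 2 := by
  have := isProbabilityMeasure_ballMeasure hr
  obtain ⟨F, hF⟩ : ∃ F : Finset (Fin 2 → ℤ), ∀ n ∉ F,
      1 ≤ ∫ h, ‖UnitAddTorus.mFourier n (proj h) - 1‖ ^ 2 ∂ballMeasure r := by
    have h := eventually_one_le_integral hr
    rw [eventually_cofinite] at h
    exact ⟨h.toFinset, fun n hn => by simpa using hn⟩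
  refine ⟨F, fun v => ?_⟩
  -- It suffices to bound Parseval sums over finite `G ⊇ F`. This keeps the interchange of sum and
  -- `h`-integral finite.
  refine le_of_tendsto (hasSum_modeEnergy v) ((eventually_ge_atTop F).mono fun G hG => ?_)
  classical
  rw [← Finset.sum_sdiff hG, add_comm, structureFunction_sq hr]
  gcongr
  have hint (n : Fin 2 → ℤ) :
      Integrable (fun h => modeEnergy (translate h v - v) n) (ballMeasure r) := by
    have := continuous_proj
    simp only [modeEnergy_translate_sub]
    refine .mul_const (.of_bound (by fun_prop) 4 (.of_forall fun h => ?_)) _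
    have h1 : ‖UnitAddTorus.mFourier n (proj h) - 1‖ ≤ 1 + 1 := by
      exact (norm_sub_le _ _).trans (add_le_add (norm_mFourier_apply n _).le (by simp))
    rw [norm_pow, norm_norm]
    nlinarith [norm_nonneg (UnitAddTorus.mFourier n (proj h) - 1)]
  calc ∑ n ∈ G \ F, modeEnergy v n
      ≤ ∑ n ∈ G \ F, ∫ h, modeEnergy (translate h v - v) n ∂ballMeasure r := by
        refine Finset.sum_le_sum fun n hn => ?_
        simp only [modeEnergy_translate_sub]
        rw [integral_mul_const]
        exact le_mul_of_one_le_left (modeEnergy_nonneg v n) (hF n (Finset.mem_sdiff.1 hn).2)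
    _ = ∫ h, ∑ n ∈ G \ F, modeEnergy (translate h v - v) n ∂ballMeasure r :=
        (integral_finsetSum _ fun n _ => hint n).symm
    _ ≤ _ := by
        refine integral_mono (integrable_finsetSum _ fun n _ => hint n)
          (integrable_norm_translate_sub _ v) fun h => ?_
        exact sum_le_hasSum _ (fun n _ => modeEnergy_nonneg _ n) (hasSum_modeEnergy _)

/-! ### Single modes and the `H^{-L}` norm -/

theorem modeEnergy_le_negSobolevNorm {L : ℝ} (hL : 0 ≤ L) (v : L2x) (n : Fin 2 → ℤ) :
    modeEnergy v n ≤ (1 + ∑ i, (n i : ℝ) ^ 2) ^ L * negSobolevNorm L v ^ 2 := by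
  have hw (n : Fin 2 → ℤ) : 1 ≤ 1 + ∑ i, (n i : ℝ) ^ 2 := by
    have : 0 ≤ ∑ i, (n i : ℝ) ^ 2 := by positivity
    linarith
  have hnn (n : Fin 2 → ℤ) : 0 ≤ (1 + ∑ i, (n i : ℝ) ^ 2) ^ (-L) * modeEnergy v n :=
    mul_nonneg (Real.rpow_nonneg (by linarith [hw n]) _) (modeEnergy_nonneg v n)
  have hs : Summable fun n : Fin 2 → ℤ => (1 + ∑ i, (n i : ℝ) ^ 2) ^ (-L) * modeEnergy v n :=
    .of_nonneg_of_le hnn (fun n => mul_le_of_le_one_left (modeEnergy_nonneg v n)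
      (Real.rpow_le_one_of_one_le_of_nonpos (hw n) (by linarith))) (hasSum_modeEnergy v).summable
  have h2 : negSobolevNorm L v ^ 2
      = ∑' n : Fin 2 → ℤ, (1 + ∑ i, (n i : ℝ) ^ 2) ^ (-L) * modeEnergy v n :=
    Real.sq_sqrt (tsum_nonneg hnn)
  have h1 := hs.le_tsum n fun m _ => hnn m
  rw [← h2] at h1
  have hp : 0 < 1 + ∑ i, (n i : ℝ) ^ 2 := by linarith [hw n]
  rwa [Real.rpow_neg hp.le, inv_mul_le_iff₀ (Real.rpow_pos_of_pos hp L)] at h1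

/-! ### Exchange of time exponents and a sequential compactness criterion -/

/-- Splitting at a level `η` gives `f^b ≤ η^b + (N^b / η^a) f^a`: the first term covers `f ≤ η`, the
second `η ≤ f ≤ N`. It is used with `(a, b) = (p, 2)` and `(2, p)`. -/
theorem exists_pos_integral_rpow_le {Ω : Type*} [MeasurableSpace Ω] (μ : Measure Ω)
    [IsFiniteMeasure μ] {a b : ℝ} (ha : 0 < a) (hb : 0 < b) (M : ℝ) {ε : ℝ} (hε : 0 < ε) :
    ∃ δ > 0, ∀ f : Ω → ℝ, AEStronglyMeasurable f μ → (∀ x, 0 ≤ f x) → (∀ᵐ x ∂μ, f x ≤ M) →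
      ∫ x, f x ^ a ∂μ ≤ δ → ∫ x, f x ^ b ∂μ ≤ ε := by
  set N := max M 1
  have hN : 0 < N := lt_max_of_lt_right one_pos
  set m := μ.real univ
  have hm : 0 ≤ m := measureReal_nonneg
  -- Chosen so that `m * η ^ b ≤ ε / 2`; the `+ 1` covers the zero measure.
  set η := (ε / 2 / (m + 1)) ^ b⁻¹
  have hη : 0 < η := Real.rpow_pos_of_pos (by positivity) _
  have hηb : η ^ b = ε / 2 / (m + 1) := Real.rpow_inv_rpow (by positivity) hb.ne'
  have hNb : 0 < N ^ b := Real.rpow_pos_of_pos hN _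
  have hηa : 0 < η ^ a := Real.rpow_pos_of_pos hη _
  refine ⟨ε / 2 * (η ^ a / N ^ b), by positivity, fun f hf h0 hM hint => ?_⟩
  have hi {c : ℝ} (hc : 0 < c) : Integrable (fun x => f x ^ c) μ := by
    refine .of_bound (hf.aemeasurable.pow_const c).aestronglyMeasurable (N ^ c) ?_
    filter_upwards [hM] with x hx
    rw [Real.norm_of_nonneg (Real.rpow_nonneg (h0 x) c)]
    exact Real.rpow_le_rpow (h0 x) (hx.trans (le_max_left _ _)) hc.le
  have hpt : ∀ᵐ x ∂μ, f x ^ b ≤ η ^ b + N ^ b / η ^ a * f x ^ a := by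
    filter_upwards [hM] with x hx
    have hfa := Real.rpow_nonneg (h0 x) a
    rcases le_total (f x) η with h | h
    · have := Real.rpow_le_rpow (h0 x) h hb.le
      have : 0 ≤ N ^ b / η ^ a * f x ^ a := by positivity
      linarith
    · have h1 := Real.rpow_le_rpow (h0 x) (hx.trans (le_max_left M 1)) hb.le
      have h2 := Real.rpow_le_rpow hη.le h ha.le
      have h3 : N ^ b ≤ N ^ b / η ^ a * f x ^ a := by
        rw [div_mul_eq_mul_div, le_div_iff₀ hηa]
        gcongr
      have : 0 ≤ η ^ b := by positivity
      linarith
  calc ∫ x, f x ^ b ∂μ ≤ ∫ x, (η ^ b + N ^ b / η ^ a * f x ^ a) ∂μ :=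
        integral_mono_ae (hi hb) ((integrable_const _).add ((hi ha).const_mul _)) hpt
    _ = m * η ^ b + N ^ b / η ^ a * ∫ x, f x ^ a ∂μ := by
        rw [integral_add (integrable_const _) ((hi ha).const_mul _), integral_const_mul,
          integral_const, smul_eq_mul]
    _ ≤ ε / 2 + ε / 2 := by
        gcongr
        · rw [hηb, mul_div_assoc', div_le_iff₀ (by positivity)]
          nlinarith
        · calc N ^ b / η ^ a * ∫ x, f x ^ a ∂μ
              ≤ N ^ b / η ^ a * (ε / 2 * (η ^ a / N ^ b)) := by gcongr
            _ = ε / 2 := by field_simp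
    _ = ε := add_halves ε

theorem dist_toLp_rpow {Ω E : Type*} [MeasurableSpace Ω] {μ : Measure Ω} [NormedAddCommGroup E]
    {p : ℝ≥0∞} [hp1 : Fact (1 ≤ p)] (hp : p ≠ ⊤) {f g : Ω → E} (hf : MemLp f p μ)
    (hg : MemLp g p μ) :
    dist (hf.toLp f) (hg.toLp g) ^ p.toReal = ∫ x, ‖f x - g x‖ ^ p.toReal ∂μ := by
  have h0 : p ≠ 0 := (one_pos.trans_le hp1.out).ne'
  have hpos : 0 < p.toReal := ENNReal.toReal_pos h0 hp
  have hnn : 0 ≤ ∫ x, ‖f x - g x‖ ^ p.toReal ∂μ :=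
    integral_nonneg fun x => Real.rpow_nonneg (norm_nonneg _) _
  rw [dist_eq_norm, ← MemLp.toLp_sub, Lp.norm_toLp,
    (hf.sub hg).eLpNorm_eq_integral_rpow_norm h0 hp]
  simp only [Pi.sub_apply]
  rw [ENNReal.toReal_ofReal (Real.rpow_nonneg hnn _), Real.rpow_inv_rpow hnn hpos.ne']

/-- Points of the closure are replaced by terms `f (κ n)` within `1 / (n + 1)`. The indices `κ n`
may repeat or decrease, so the hypothesis must allow every `κ`. -/
theorem isCompact_closure_range_of_cauchySeq {X : Type*} [MetricSpace X] [CompleteSpace X]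
    {f : ℕ → X} (h : ∀ κ : ℕ → ℕ, ∃ ψ : ℕ → ℕ, StrictMono ψ ∧ CauchySeq (f ∘ κ ∘ ψ)) :
    IsCompact (closure (range f)) := by
  refine IsSeqCompact.isCompact fun x hx => ?_
  have h1 (n : ℕ) : ∃ k, dist (x n) (f k) < 1 / ((n : ℝ) + 1) := by
    obtain ⟨y, ⟨k, rfl⟩, hk⟩ := Metric.mem_closure_iff.1 (hx n) (1 / ((n : ℝ) + 1)) (by positivity)
    exact ⟨k, hk⟩
  choose κ hκ using h1
  obtain ⟨ψ, hψ, hc⟩ := h κ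
  obtain ⟨a, ha⟩ := cauchySeq_tendsto_of_complete hc
  have hlim : Tendsto (x ∘ ψ) atTop (𝓝 a) := by
    refine (tendsto_iff_of_dist ?_).2 ha
    refine squeeze_zero (fun _ => dist_nonneg) (fun n => (hκ (ψ n)).le) ?_
    exact tendsto_one_div_add_atTop_nhds_zero_nat.comp hψ.tendsto_atTop
  exact ⟨a, isClosed_closure.mem_of_tendsto hlim (.of_forall fun n => hx _), ψ, hψ, hlim⟩

/-! ### Arzelà–Ascoli for the Fourier coefficients -/

theorem norm_coef_sq_le (v : L2x) (n : Fin 2 → ℤ) (j : Fin 2) : ‖coef v n j‖ ^ 2 ≤ modeEnergy v n :=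
  Finset.single_le_sum (f := fun j => ‖coef v n j‖ ^ 2) (fun _ _ => by positivity)
    (Finset.mem_univ j)

theorem modeEnergy_le_norm_sq (v : L2x) (n : Fin 2 → ℤ) : modeEnergy v n ≤ ‖v‖ ^ 2 :=
  le_hasSum (hasSum_modeEnergy v) n fun m _ => modeEnergy_nonneg v m

theorem continuous_coef (n : Fin 2 → ℤ) (j : Fin 2) : Continuous fun v : L2x => coef v n j := by
  refine (LipschitzWith.of_dist_le_mul (K := 1) fun v w => ?_).continuous
  rw [dist_eq_norm, dist_eq_norm, ← coef_sub, NNReal.coe_one, one_mul]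
  exact (sq_le_sq₀ (norm_nonneg _) (norm_nonneg _)).1
    ((norm_coef_sq_le _ n j).trans (modeEnergy_le_norm_sq _ n))

theorem continuous_modeEnergy (n : Fin 2 → ℤ) : Continuous fun v : L2x => modeEnergy v n := by
  have := continuous_coef n
  unfold modeEnergy
  fun_prop

theorem norm_coef_le_negSobolevNorm {L : ℝ} (hL : 0 ≤ L) (n : Fin 2 → ℤ) :
    ∃ K > 0, ∀ v : L2x, ∀ j, ‖coef v n j‖ ≤ K * negSobolevNorm L v := by
  have hp : 0 < 1 + ∑ i, (n i : ℝ) ^ 2 := by positivity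
  have hW := Real.rpow_pos_of_pos hp L
  refine ⟨√((1 + ∑ i, (n i : ℝ) ^ 2) ^ L), Real.sqrt_pos.2 hW, fun v j => ?_⟩
  have h0 : 0 ≤ negSobolevNorm L v := Real.sqrt_nonneg _
  refine (sq_le_sq₀ (norm_nonneg _) (by positivity)).1 ?_
  rw [mul_pow, Real.sq_sqrt hW.le]
  exact (norm_coef_sq_le v n j).trans (modeEnergy_le_negSobolevNorm hL v n)

/-- Pointwise in time compactness of the Fourier coefficients of a sequence that is bounded in
`Lip([0,T);H^{-L})`. -/
theorem exists_subseq_tendsto_modeEnergy {T L C : ℝ} (hT : 0 < T) (hL : 0 ≤ L) {v : ℕ → ℝ → L2x}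
    (hb : ∀ k, ∀ t ∈ Ico 0 T, negSobolevNorm L (v k t) ≤ C)
    (hlip : ∀ k, ∀ s ∈ Ico 0 T, ∀ t ∈ Ico 0 T,
      negSobolevNorm L (v k t - v k s) ≤ C * |t - s|) :
    ∃ ψ : ℕ → ℕ, StrictMono ψ ∧ ∀ t ∈ Ico 0 T, ∀ n,
      Tendsto (fun m : ℕ × ℕ => modeEnergy (v (ψ m.1) t - v (ψ m.2) t) n) atTop (𝓝 0) := by
  choose K hK0 hK using norm_coef_le_negSobolevNorm hL
  have hC : 0 ≤ C := (Real.sqrt_nonneg _).trans (hb 0 0 ⟨le_rfl, hT⟩)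
  -- The diagonal extraction is Tychonoff on a product of closed discs, indexed by rational times,
  -- modes and components. The index set is countable, so compactness yields a subsequence.
  obtain ⟨a, -, ψ, hψ, ha⟩ := (isCompact_univ_pi
    (X := fun _ : {q : ℚ // (q : ℝ) ∈ Ico 0 T} × (Fin 2 → ℤ) × Fin 2 => ℂ)
    fun i => isCompact_closedBall (0 : ℂ) (K i.2.1 * C)).tendsto_subseq
    (x := fun k i => coef (v k i.1.1) i.2.1 i.2.2) (fun k i _ => by
      rw [mem_closedBall_zero_iff]
      exact (hK _ _ _).trans (mul_le_mul_of_nonneg_left (hb k _ i.1.2) (hK0 _).le))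
  have hcauchy : ∀ t ∈ Ico 0 T, ∀ n j, CauchySeq fun m => coef (v (ψ m) t) n j := by
    intro t ht n j
    have hlip' (k : ℕ) (q : ℝ) (hq : q ∈ Ico 0 T) :
        dist (coef (v k t) n j) (coef (v k q) n j) ≤ K n * C * |t - q| := by
      rw [dist_eq_norm, ← coef_sub, mul_assoc]
      exact (hK _ _ _).trans (mul_le_mul_of_nonneg_left (hlip k q hq t ht) (hK0 _).le)
    refine Metric.cauchySeq_iff'.2 fun ε hε => ?_
    set η := ε / (4 * (K n * C + 1))
    have hKC : 0 ≤ K n * C := mul_nonneg (hK0 n).le hC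
    have hη : 0 < η := by positivity
    -- The rational time is taken to the right of `t`, which also works at `t = 0`. Three errors of
    -- at most `ε / 4` then add up to less than `ε`.
    obtain ⟨q, hq1, hq2⟩ := exists_rat_btwn (lt_min ht.2 (lt_add_of_pos_right t hη))
    have hqI : (q : ℝ) ∈ Ico 0 T := ⟨ht.1.trans hq1.le, hq2.trans_le (min_le_left _ _)⟩
    have hqa : |t - q| ≤ η := by
      rw [abs_le]
      constructor <;> linarith [hq2.trans_le (min_le_right _ _)]
    have hε4 : K n * C * |t - q| ≤ ε / 4 := by
      calc K n * C * |t - q| ≤ (K n * C + 1) * η := by gcongr; linarith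
        _ = ε / 4 := by simp only [η]; field_simp
    have hlim : Tendsto (fun m => coef (v (ψ m) q) n j) atTop (𝓝 (a (⟨q, hqI⟩, n, j))) :=
      tendsto_pi_nhds.1 ha (⟨q, hqI⟩, n, j)
    obtain ⟨N, hN⟩ := Metric.cauchySeq_iff'.1 hlim.cauchySeq (ε / 4) (by positivity)
    refine ⟨N, fun m hm => ?_⟩
    have h1 := hlip' (ψ m) q hqI
    have h2 := hlip' (ψ N) q hqI
    rw [dist_comm] at h2
    have h3 := hN m hm
    have := dist_triangle4 (coef (v (ψ m) t) n j) (coef (v (ψ m) q) n j) (coef (v (ψ N) q) n j)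
      (coef (v (ψ N) t) n j)
    linarith
  refine ⟨ψ, hψ, fun t ht n => ?_⟩
  have h (j : Fin 2) : Tendsto (fun m : ℕ × ℕ => ‖coef (v (ψ m.1) t - v (ψ m.2) t) n j‖ ^ 2) atTop
      (𝓝 0) := by
    simpa [coef_sub, ← dist_eq_norm] using
      (cauchySeq_iff_tendsto_dist_atTop_0.1 (hcauchy t ht n j)).pow 2
  simpa [modeEnergy] using tendsto_finsetSum Finset.univ fun j _ => h j

/-! ### Time-integrated estimates -/

theorem integrable_of_continuous_of_le_norm_sq {T M : ℝ} {w : ℝ → L2x}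
    (hw : AEStronglyMeasurable w (timeMeasure T)) (hM : ∀ᵐ t ∂timeMeasure T, ‖w t‖ ≤ M)
    {G : L2x → ℝ} (hG : Continuous G) (h0 : ∀ v, 0 ≤ G v) {c : ℝ} (hc : 0 ≤ c)
    (hle : ∀ v, G v ≤ c * ‖v‖ ^ 2) : Integrable (fun t => G (w t)) (timeMeasure T) := by
  refine .of_bound (hG.comp_aestronglyMeasurable hw) (c * M ^ 2) ?_
  filter_upwards [hM] with t ht
  rw [Real.norm_of_nonneg (h0 _)]
  refine (hle _).trans ?_
  gcongr

theorem integrable_norm_sq_time {T M : ℝ} {w : ℝ → L2x}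
    (hw : AEStronglyMeasurable w (timeMeasure T)) (hM : ∀ᵐ t ∂timeMeasure T, ‖w t‖ ≤ M) :
    Integrable (fun t => ‖w t‖ ^ 2) (timeMeasure T) :=
  integrable_of_continuous_of_le_norm_sq hw hM (G := fun v => ‖v‖ ^ 2) (by fun_prop)
    (fun v => by positivity) zero_le_one fun v => (one_mul _).ge

theorem integrable_modeEnergy {T M : ℝ} {w : ℝ → L2x}
    (hw : AEStronglyMeasurable w (timeMeasure T)) (hM : ∀ᵐ t ∂timeMeasure T, ‖w t‖ ≤ M)
    (n : Fin 2 → ℤ) : Integrable (fun t => modeEnergy (w t) n) (timeMeasure T) :=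
  integrable_of_continuous_of_le_norm_sq hw hM (continuous_modeEnergy n)
    (fun v => modeEnergy_nonneg v n) zero_le_one fun v => by
      rw [one_mul]; exact modeEnergy_le_norm_sq v n

theorem integrable_structureFunction_sq {T M r : ℝ} (hr : 0 < r) {w : ℝ → L2x}
    (hw : AEStronglyMeasurable w (timeMeasure T)) (hM : ∀ᵐ t ∂timeMeasure T, ‖w t‖ ≤ M) :
    Integrable (fun t => structureFunction (w t) r ^ 2) (timeMeasure T) :=
  integrable_of_continuous_of_le_norm_sq hw hM (continuous_structureFunction_sq hr)
    (fun v => by positivity) (by norm_num) fun v => structureFunction_sq_le hr v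

theorem timeStructureFunction_nonneg (T : ℝ) (w : ℝ → L2x) (r : ℝ) :
    0 ≤ timeStructureFunction T w r :=
  Real.sqrt_nonneg _

theorem timeStructureFunction_sq (T : ℝ) (w : ℝ → L2x) (r : ℝ) :
    timeStructureFunction T w r ^ 2 = ∫ t in Ioo 0 T, structureFunction (w t) r ^ 2 :=
  Real.sq_sqrt (integral_nonneg fun t => by positivity)

theorem timeStructureFunction_sub_sq_le {T M r : ℝ} (hr : 0 < r) {v w : ℝ → L2x}
    (hv : AEStronglyMeasurable v (timeMeasure T)) (hvM : ∀ᵐ t ∂timeMeasure T, ‖v t‖ ≤ M)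
    (hw : AEStronglyMeasurable w (timeMeasure T)) (hwM : ∀ᵐ t ∂timeMeasure T, ‖w t‖ ≤ M) :
    ∫ t in Ioo 0 T, structureFunction (v t - w t) r ^ 2
      ≤ 2 * timeStructureFunction T v r ^ 2 + 2 * timeStructureFunction T w r ^ 2 := by
  have hiv := (integrable_structureFunction_sq hr hv hvM).const_mul 2
  have hiw := (integrable_structureFunction_sq hr hw hwM).const_mul 2
  rw [timeStructureFunction_sq, timeStructureFunction_sq, ← integral_const_mul,
    ← integral_const_mul, ← integral_add hiv hiw]
  exact integral_mono_of_nonneg (.of_forall fun t => sq_nonneg _) (hiv.add hiw)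
    (.of_forall fun t => structureFunction_sub_sq_le hr (v t) (w t))

/-- The parallelogram-type bound for `v = (v - w) + w` gives a factor 2 and `S₂(v - w)² ≤ 4 ‖v -
w‖²` a factor 4, whence the 8. -/
theorem timeStructureFunction_sq_le_add {T M r : ℝ} (hr : 0 < r) {v w : ℝ → L2x}
    (hv : AEStronglyMeasurable v (timeMeasure T)) (hvM : ∀ᵐ t ∂timeMeasure T, ‖v t‖ ≤ M)
    (hw : AEStronglyMeasurable w (timeMeasure T)) (hwM : ∀ᵐ t ∂timeMeasure T, ‖w t‖ ≤ M) :
    timeStructureFunction T v r ^ 2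
      ≤ 8 * (∫ t in Ioo 0 T, ‖v t - w t‖ ^ 2) + 2 * timeStructureFunction T w r ^ 2 := by
  have hd : ∀ᵐ t ∂timeMeasure T, ‖v t - w t‖ ≤ M + M := by
    filter_upwards [hvM, hwM] with t h1 h2 using (norm_sub_le _ _).trans (add_le_add h1 h2)
  have hid : Integrable (fun t => 8 * ‖v t - w t‖ ^ 2) (timeMeasure T) :=
    (integrable_norm_sq_time (hv.sub hw) hd).const_mul 8
  have hiw := (integrable_structureFunction_sq hr hw hwM).const_mul 2
  rw [timeStructureFunction_sq, timeStructureFunction_sq, ← integral_const_mul,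
    ← integral_const_mul, ← integral_add hid hiw]
  refine integral_mono_of_nonneg (.of_forall fun t => sq_nonneg _) (hid.add hiw)
    (.of_forall fun t => ?_)
  have h1 := structureFunction_add_sq_le hr (v t - w t) (w t)
  have h2 := structureFunction_sq_le hr (v t - w t)
  rw [sub_add_cancel] at h1
  dsimp only
  linarith

theorem tendsto_timeStructureFunction_sq {T M : ℝ} {w : ℝ → L2x}
    (hw : AEStronglyMeasurable w (timeMeasure T)) (hM : ∀ᵐ t ∂timeMeasure T, ‖w t‖ ≤ M) :
    Tendsto (fun r => timeStructureFunction T w r ^ 2) (𝓝[>] 0) (𝓝 0) := by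
  simp only [timeStructureFunction_sq]
  rw [show 𝓝 (0 : ℝ) = 𝓝 (∫ _, (0 : ℝ) ∂timeMeasure T) by rw [integral_zero]]
  refine tendsto_integral_filter_of_dominated_convergence (fun _ => 4 * M ^ 2) ?_ ?_
    (integrable_const _) (.of_forall fun t => tendsto_structureFunction_sq (w t))
  · filter_upwards [self_mem_nhdsWithin] with r hr
    exact (integrable_structureFunction_sq hr hw hM).aestronglyMeasurable
  · filter_upwards [self_mem_nhdsWithin] with r hr
    filter_upwards [hM] with t ht
    rw [norm_pow, Real.norm_eq_abs, sq_abs]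
    refine (structureFunction_sq_le hr _).trans ?_
    gcongr

theorem timeStructureFunction_le {T M r : ℝ} (hr : 0 < r) {w : ℝ → L2x}
    (hM : ∀ᵐ t ∂timeMeasure T, ‖w t‖ ≤ M) :
    timeStructureFunction T w r ≤ √(∫ _ in Ioo 0 T, 4 * M ^ 2) := by
  refine Real.sqrt_le_sqrt (integral_mono_of_nonneg (.of_forall fun t => sq_nonneg _)
    (integrable_const _) ?_)
  filter_upwards [hM] with t ht
  refine (structureFunction_sq_le hr _).trans ?_
  gcongr

/-! ### From finite nets to a modulus of continuity -/

theorem exists_modulusOfContinuity {T M : ℝ} {u : ℕ → ℝ → L2x}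
    (hu : ∀ k, AEStronglyMeasurable (u k) (timeMeasure T))
    (hM : ∀ k, ∀ᵐ t ∂timeMeasure T, ‖u k t‖ ≤ M)
    (hnet : ∀ ε > 0, ∃ I : Set ℕ, I.Finite ∧ ∀ k, ∃ i ∈ I,
      ∫ t in Ioo 0 T, ‖u k t - u i t‖ ^ 2 ≤ ε) :
    ∃ φ : ℝ → ℝ, IsModulusOfContinuity φ ∧
      ∀ r : ℝ, 0 < r → ∀ k : ℕ, timeStructureFunction T (u k) r ≤ φ r := by
  -- The supremum over `k` is the smallest possible modulus; it is finite by the uniform `L²` bound.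
  refine ⟨fun r => ⨆ k, timeStructureFunction T (u k) r,
    ⟨fun r _ => Real.iSup_nonneg fun k => Real.sqrt_nonneg _, ?_⟩,
    fun r hr k => le_ciSup (f := fun k => timeStructureFunction T (u k) r)
      ⟨_, forall_mem_range.2 fun k => timeStructureFunction_le hr (hM k)⟩ k⟩
  rw [Metric.tendsto_nhds]
  intro ε hε
  -- The constants are balanced as `8 · ε²/64 + 2 · ε²/16 = (ε/2)²`.
  obtain ⟨I, hI, hnet⟩ := hnet (ε ^ 2 / 64) (by positivity)
  have hev : ∀ᶠ r in 𝓝[>] (0 : ℝ), ∀ i ∈ I, timeStructureFunction T (u i) r ^ 2 < ε ^ 2 / 16 :=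
    (eventually_all_finite hI).2 fun i _ =>
      (tendsto_timeStructureFunction_sq (hu i) (hM i)).eventually_lt_const (by positivity)
  filter_upwards [hev, self_mem_nhdsWithin] with r h1 hr
  rw [Real.dist_eq, sub_zero, abs_of_nonneg (Real.iSup_nonneg fun k => timeStructureFunction_nonneg _ _ _)]
  refine lt_of_le_of_lt (ciSup_le fun k => ?_) (half_lt_self hε)
  obtain ⟨i, hi, hki⟩ := hnet k
  refine (sq_le_sq₀ (Real.sqrt_nonneg _) (half_pos hε).le).1 ?_
  have := timeStructureFunction_sq_le_add hr (hu k) (hM k) (hu i) (hM i)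
  have := h1 i hi
  change timeStructureFunction T (u k) r ^ 2 ≤ _
  linarith

/-! ### From a modulus of continuity to Cauchy subsequences -/

theorem tendsto_integral_norm_sub_sq {T M L C : ℝ} (hT : 0 < T) (hL : 0 ≤ L) {v : ℕ → ℝ → L2x}
    (hv : ∀ k, AEStronglyMeasurable (v k) (timeMeasure T))
    (hM : ∀ k, ∀ᵐ t ∂timeMeasure T, ‖v k t‖ ≤ M)
    (hb : ∀ k, ∀ t ∈ Ico 0 T, negSobolevNorm L (v k t) ≤ C)
    (hlip : ∀ k, ∀ s ∈ Ico 0 T, ∀ t ∈ Ico 0 T,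
      negSobolevNorm L (v k t - v k s) ≤ C * |t - s|)
    {φ : ℝ → ℝ} (hφ : IsModulusOfContinuity φ)
    (hle : ∀ r : ℝ, 0 < r → ∀ k : ℕ, timeStructureFunction T (v k) r ≤ φ r) :
    ∃ ψ : ℕ → ℕ, StrictMono ψ ∧
      Tendsto (fun m : ℕ × ℕ => ∫ t in Ioo 0 T, ‖v (ψ m.1) t - v (ψ m.2) t‖ ^ 2) atTop (𝓝 0) := by
  obtain ⟨ψ, hψ, hmode⟩ := exists_subseq_tendsto_modeEnergy hT hL hb hlip
  refine ⟨ψ, hψ, ?_⟩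
  have hmeas (k l : ℕ) : AEStronglyMeasurable (fun t => v k t - v l t) (timeMeasure T) :=
    (hv k).sub (hv l)
  have hbd (k l : ℕ) : ∀ᵐ t ∂timeMeasure T, ‖v k t - v l t‖ ≤ M + M := by
    filter_upwards [hM k, hM l] with t h1 h2 using (norm_sub_le _ _).trans (add_le_add h1 h2)
  have hint (n : Fin 2 → ℤ) : Tendsto (fun m : ℕ × ℕ =>
      ∫ t in Ioo 0 T, modeEnergy (v (ψ m.1) t - v (ψ m.2) t) n) atTop (𝓝 0) := by
    rw [show 𝓝 (0 : ℝ) = 𝓝 (∫ _, (0 : ℝ) ∂timeMeasure T) by rw [integral_zero]]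
    refine tendsto_integral_filter_of_dominated_convergence (fun _ => (M + M) ^ 2)
      (.of_forall fun m => (integrable_modeEnergy (hmeas _ _) (hbd _ _) n).aestronglyMeasurable)
      (.of_forall fun m => ?_) (integrable_const _) ?_
    · filter_upwards [hbd (ψ m.1) (ψ m.2)] with t ht
      rw [Real.norm_of_nonneg (modeEnergy_nonneg _ _)]
      refine (modeEnergy_le_norm_sq _ _).trans ?_
      gcongr
    · filter_upwards [ae_restrict_mem measurableSet_Ioo] with t ht
      exact hmode t (Ioo_subset_Ico_self ht) n
  rw [Metric.tendsto_nhds]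
  intro ε hε
  -- The structure function of a difference contributes at most `2 φ(r)² + 2 φ(r)²`. The radius `r`
  -- is fixed first, because the finite set `F` of low modes depends on it.
  have hφ2 : Tendsto (fun r => 4 * φ r ^ 2) (𝓝[>] 0) (𝓝 0) := by
    simpa using (hφ.tendsto_zero.pow 2).const_mul 4
  obtain ⟨r, hrε, hr⟩ := ((hφ2.eventually_lt_const (half_pos hε)).and self_mem_nhdsWithin).exists
  replace hr : 0 < r := hr
  obtain ⟨F, hF⟩ := exists_finset_norm_sq_le hr
  have hsum := tendsto_finsetSum F fun n _ => hint n
  rw [Finset.sum_const_zero] at hsum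
  filter_upwards [hsum.eventually_lt_const (half_pos hε)] with m hm
  rw [Real.dist_eq, sub_zero, abs_of_nonneg (integral_nonneg fun t => by positivity)]
  have hiF (n : Fin 2 → ℤ) := integrable_modeEnergy (hmeas (ψ m.1) (ψ m.2)) (hbd _ _) n
  have hiS := integrable_structureFunction_sq hr (hmeas (ψ m.1) (ψ m.2)) (hbd _ _)
  have h1 : ∫ t in Ioo 0 T, ‖v (ψ m.1) t - v (ψ m.2) t‖ ^ 2
      ≤ ∑ n ∈ F, (∫ t in Ioo 0 T, modeEnergy (v (ψ m.1) t - v (ψ m.2) t) n)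
        + ∫ t in Ioo 0 T, structureFunction (v (ψ m.1) t - v (ψ m.2) t) r ^ 2 := by
    rw [← integral_finsetSum _ fun n _ => hiF n,
      ← integral_add (integrable_finsetSum _ fun n _ => hiF n) hiS]
    exact integral_mono_of_nonneg (.of_forall fun t => sq_nonneg _)
      ((integrable_finsetSum _ fun n _ => hiF n).add hiS) (.of_forall fun t => hF _)
  have h2 := timeStructureFunction_sub_sq_le hr (hv (ψ m.1)) (hM _) (hv (ψ m.2)) (hM _)
  have h3 (k : ℕ) : timeStructureFunction T (v k) r ^ 2 ≤ φ r ^ 2 :=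
    pow_le_pow_left₀ (Real.sqrt_nonneg _) (hle r hr k) 2
  linarith [h3 (ψ m.1), h3 (ψ m.2)]

/-! ### Passage between `L^p` and `L²` in time, and the conclusion -/

theorem exists_finite_net_of_isCompact_closure {p : ℝ≥0∞} [hp1 : Fact (1 ≤ p)] (hp : p ≠ ⊤)
    {T M : ℝ} {u : ℕ → ℝ → L2x} (hu : ∀ k, MemLp (u k) p (timeMeasure T))
    (hM : ∀ k, ∀ᵐ t ∂timeMeasure T, ‖u k t‖ ≤ M)
    (hcpt : IsCompact (closure (range fun k => (hu k).toLp (u k)))) {ε : ℝ} (hε : 0 < ε) :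
    ∃ I : Set ℕ, I.Finite ∧ ∀ k, ∃ i ∈ I, ∫ t in Ioo 0 T, ‖u k t - u i t‖ ^ 2 ≤ ε := by
  have hpos : 0 < p.toReal := ENNReal.toReal_pos (one_pos.trans_le hp1.out).ne' hp
  obtain ⟨δ, hδ, H⟩ := exists_pos_integral_rpow_le (timeMeasure T) hpos two_pos (M + M) hε
  have htb : TotallyBounded (range fun k => (hu k).toLp (u k)) :=
    hcpt.totallyBounded.subset subset_closure
  obtain ⟨t, hts, htf, hcov⟩ := htb.exists_subset
    (Metric.dist_mem_uniformity (Real.rpow_pos_of_pos hδ p.toReal⁻¹))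
  -- The centres of the net lie in the range of the sequence, and `Function.invFun` selects an index
  -- for each.
  refine ⟨Function.invFun (fun k => (hu k).toLp (u k)) '' t, htf.image _, fun k => ?_⟩
  obtain ⟨y, hy, hky⟩ := mem_iUnion₂.1 (hcov (mem_range_self k))
  refine ⟨_, mem_image_of_mem _ hy, ?_⟩
  set i := Function.invFun (fun k => (hu k).toLp (u k)) y
  have hi : (hu i).toLp (u i) = y := Function.invFun_eq (hts hy)
  have hdist : dist ((hu k).toLp (u k)) ((hu i).toLp (u i)) < δ ^ p.toReal⁻¹ := by
    rw [hi]; exact hky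
  have hle : ∫ t in Ioo 0 T, ‖u k t - u i t‖ ^ p.toReal ≤ δ := by
    rw [← dist_toLp_rpow hp (hu k) (hu i)]
    refine (Real.rpow_le_rpow dist_nonneg hdist.le hpos.le).trans_eq ?_
    exact Real.rpow_inv_rpow hδ.le hpos.ne'
  have hbd : ∀ᵐ t ∂timeMeasure T, ‖u k t - u i t‖ ≤ M + M := by
    filter_upwards [hM k, hM i] with t h1 h2 using (norm_sub_le _ _).trans (add_le_add h1 h2)
  simpa only [Real.rpow_two, Pi.sub_apply] using H _
    ((hu k).aestronglyMeasurable.sub (hu i).aestronglyMeasurable).norm (fun _ => norm_nonneg _)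
    hbd hle

theorem cauchySeq_toLp {p : ℝ≥0∞} [hp1 : Fact (1 ≤ p)] (hp : p ≠ ⊤) {T M : ℝ} {v : ℕ → ℝ → L2x}
    (hv : ∀ k, MemLp (v k) p (timeMeasure T)) (hM : ∀ k, ∀ᵐ t ∂timeMeasure T, ‖v k t‖ ≤ M)
    (hlim : Tendsto (fun m : ℕ × ℕ => ∫ t in Ioo 0 T, ‖v m.1 t - v m.2 t‖ ^ 2) atTop (𝓝 0)) :
    CauchySeq fun k => (hv k).toLp (v k) := by
  have hpos : 0 < p.toReal := ENNReal.toReal_pos (one_pos.trans_le hp1.out).ne' hp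
  rw [cauchySeq_iff_tendsto_dist_atTop_0, Metric.tendsto_nhds]
  intro ε hε
  obtain ⟨δ, hδ, H⟩ := exists_pos_integral_rpow_le (timeMeasure T) two_pos hpos (M + M)
    (Real.rpow_pos_of_pos (half_pos hε) p.toReal)
  filter_upwards [hlim.eventually_lt_const hδ] with m hm
  rw [Real.dist_eq, sub_zero, abs_of_nonneg dist_nonneg]
  refine lt_of_le_of_lt ?_ (half_lt_self hε)
  rw [← Real.rpow_le_rpow_iff dist_nonneg (half_pos hε).le hpos, dist_toLp_rpow hp]
  have hbd : ∀ᵐ t ∂timeMeasure T, ‖v m.1 t - v m.2 t‖ ≤ M + M := by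
    filter_upwards [hM m.1, hM m.2] with t h1 h2 using (norm_sub_le _ _).trans (add_le_add h1 h2)
  refine H _ ((hv m.1).aestronglyMeasurable.sub (hv m.2).aestronglyMeasurable).norm
    (fun _ => norm_nonneg _) hbd ?_
  simpa only [Real.rpow_two] using hm.le

end EulerCompactness

theorem proposition2p3 (p : ℝ≥0∞) [Fact (1 ≤ p)] (hp : p ≠ ⊤) (T : ℝ) (hT : 0 < T)
    (u : ℕ → ℝ → L2x) (hu : IsApproximateSolutionSequence T u) :
    IsCompact (closure (Set.range fun k : ℕ => (hu.memLp p k).toLp (u k))) ↔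
      ∃ φ : ℝ → ℝ, IsModulusOfContinuity φ ∧
        ∀ r : ℝ, 0 < r → ∀ k : ℕ, timeStructureFunction T (u k) r ≤ φ r := by
  obtain ⟨M, hM⟩ := hu.bounded
  constructor
  · intro hcpt
    exact exists_modulusOfContinuity hu.aestronglyMeasurable hM fun ε hε =>
      exists_finite_net_of_isCompact_closure hp (hu.memLp p) hM hcpt hε
  · rintro ⟨φ, hφ, hle⟩
    obtain ⟨L, hL, C, hlip⟩ := hu.lipschitz
    refine isCompact_closure_range_of_cauchySeq fun κ => ?_
    -- All the bounds are uniform in `k`, so they pass to `u ∘ κ` for an arbitrary reindexing `κ`.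
    obtain ⟨ψ, hψ, hlim⟩ := tendsto_integral_norm_sub_sq (v := u ∘ κ) hT (zero_le_one.trans hL.le)
      (fun k => hu.aestronglyMeasurable (κ k)) (fun k => hM (κ k)) (fun k => (hlip (κ k)).1)
      (fun k => (hlip (κ k)).2) hφ fun r hr k => hle r hr (κ k)
    exact ⟨ψ, hψ, cauchySeq_toLp hp (fun m => hu.memLp p (κ (ψ m))) (fun m => hM (κ (ψ m))) hlim⟩
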